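/- A knot projection is the image of a generic immersion of a circle into the $2$-sphere, i.e. of a smooth immersion whose only self-intersections are transverse double points; it is trivial if it has no double points. Two knot projections are $(1,3)$ homotopic if they are related by a finite sequence of sphere isotopies and Reidemeister moves of types $1$ and $3$ (in either direction). Here a move of type $1$ replaces, inside a closed disc meeting the projection in one simple strand, this strand by a strand with the same endpoints and exactly one double point; a move of type $3$ replaces, inside a closed disc meeting the projection in three simple strands that cross pairwise exactly once, these strands by three such strands with the same endpoints, each of which meets the other two in the opposite order. Theorem. Let $P_0$ be a knot projection with $15$ double points, labelled $0,1,\dots,14$, whose Gauss word (the sequence of double points met when the projection is traversed once, from a suitable starting point and in a suitable direction) is $$0,3,4,1,2,6,5,4,3,7,8,5,6,10,9,8,7,11,12,9,10,14,13,12,11,0,1,2,14,13.$$ Then $P_0$ is not $(1,3)$ homotopic to a trivial knot projection. -/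

import Mathlib

open scoped Manifold ContDiff

/-- The unit sphere in Euclidean 3-space. -/
abbrev Sphere2 : Type := Metric.sphere (0 : EuclideanSpace ℝ (Fin 3)) 1

/-- The velocity, in the ambient Euclidean space, of a parametrized curve on the sphere. -/
noncomputable def velocity (γ : ℝ → Sphere2) (t : ℝ) : EuclideanSpace ℝ (Fin 3) :=
  deriv (fun u => (γ u : EuclideanSpace ℝ (Fin 3))) t

/-- A generic immersion of the circle `ℝ / ℤ` into the sphere, written as a 1-periodic map on `ℝ`:
smooth, with nowhere vanishing velocity, without triple points, and with transverse double
points. -/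
structure IsGenericImmersion (γ : ℝ → Sphere2) : Prop where
  periodic : Function.Periodic γ 1
  smooth : ContDiff ℝ ∞ (fun t => (γ t : EuclideanSpace ℝ (Fin 3)))
  immersed : ∀ t, velocity γ t ≠ 0
  no_triple : ∀ r ∈ Set.Ico (0 : ℝ) 1, ∀ s ∈ Set.Ico (0 : ℝ) 1, ∀ t ∈ Set.Ico (0 : ℝ) 1,
    γ r = γ s → γ s = γ t → r = s ∨ s = t ∨ r = t
  transverse : ∀ s ∈ Set.Ico (0 : ℝ) 1, ∀ t ∈ Set.Ico (0 : ℝ) 1, s ≠ t → γ s = γ t →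
    LinearIndependent ℝ ![velocity γ s, velocity γ t]

/-- `γ` is a generic immersion of the circle with image `P`. -/
def Parametrizes (γ : ℝ → Sphere2) (P : Set Sphere2) : Prop :=
  IsGenericImmersion γ ∧ Set.range γ = P

/-- A knot projection: the image of a generic immersion of a circle into the 2-sphere. -/
def KnotProjection : Type := {P : Set Sphere2 // ∃ γ, Parametrizes γ P}

/-- A trivial knot projection: one with no double points. -/
def KnotProjection.IsTrivial (P : KnotProjection) : Prop :=
  ∃ γ, Parametrizes γ P.1 ∧ Set.InjOn γ (Set.Ico 0 1)

/-- `P` has Gauss word `w`: running once along `P`, from a suitable starting point and in a suitable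
direction, one passes through double points exactly `n` times, at the times
`τ 0 < τ 1 < ⋯`, and the passages `i` and `j` are through the same double point exactly if
`w i = w j`. -/
def KnotProjection.HasGaussWord (P : KnotProjection) {n : ℕ} (w : Fin n → ℕ) : Prop :=
  ∃ γ, Parametrizes γ P.1 ∧ ∃ τ : Fin n → ℝ, StrictMono τ ∧ (∀ i, τ i ∈ Set.Ico (0 : ℝ) 1) ∧
    (∀ i j, γ (τ i) = γ (τ j) ↔ w i = w j) ∧
    ∀ s ∈ Set.Ico (0 : ℝ) 1, ∀ t ∈ Set.Ico (0 : ℝ) 1, s ≠ t → γ s = γ t → s ∈ Set.range τ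

/-- Sphere isotopy: a smooth ambient isotopy of the sphere carries `P` to `Q`. -/
def SphereIsotopic (P Q : KnotProjection) : Prop :=
  ∃ H : ℝ → Diffeomorph (𝓡 2) (𝓡 2) Sphere2 Sphere2 ∞,
    ContMDiff (𝓘(ℝ, ℝ).prod (𝓡 2)) (𝓡 2) ∞ (fun p : ℝ × Sphere2 => H p.1 p.2) ∧
    (∀ x, H 0 x = x) ∧ (fun x => H 1 x) '' P.1 = Q.1

/-- A closed disc in the sphere. -/
def IsClosedDisc (D : Set Sphere2) : Prop :=
  Nonempty (D ≃ₜ Metric.closedBall (0 : EuclideanSpace ℝ (Fin 2)) 1)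

/-- The part of the closed curve `γ` in `D` consists of the `n` strands given by the disjoint
parameter intervals `[a i, b i]` of the circle `ℝ / ℤ`; exactly the endpoints of the strands lie on
the boundary of `D`. -/
structure HasStrands (γ : ℝ → Sphere2) (D : Set Sphere2) {n : ℕ} (a b : Fin n → ℝ) : Prop where
  lt : ∀ i, a i < b i
  ordered : ∀ i j, i < j → b i < a j
  within_turn : ∀ i j, b i < a j + 1
  mem_iff : ∀ t, γ t ∈ D ↔ ∃ i, ∃ m : ℤ, t + m ∈ Set.Icc (a i) (b i)
  mem_interior_iff : ∀ t, γ t ∈ interior D ↔ ∃ i, ∃ m : ℤ, t + m ∈ Set.Ioo (a i) (b i)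

/-- `γ` and `δ` agree except in the interior of a closed disc, which both of them traverse in the
`n` strands with parameter intervals `[a i, b i]`. -/
def AgreeOffDisc (γ δ : ℝ → Sphere2) {n : ℕ} (a b : Fin n → ℝ) : Prop :=
  ∃ D, IsClosedDisc D ∧ HasStrands γ D a b ∧ HasStrands δ D a b ∧
    ∀ t, γ t ∉ interior D → δ t = γ t

/-- A Reidemeister move of type 1 that increases the number of double points: in a disc, a simple
strand is replaced by a strand with the same endpoints that has exactly one double point (hence
exactly one 1-gon). -/
def ReidemeisterI (P Q : KnotProjection) : Prop :=
  ∃ γ δ, Parametrizes γ P.1 ∧ Parametrizes δ Q.1 ∧ ∃ a b : Fin 1 → ℝ, AgreeOffDisc γ δ a b ∧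
    Set.InjOn γ (Set.Icc (a 0) (b 0)) ∧
    ∃ s t, a 0 < s ∧ s < t ∧ t < b 0 ∧ δ s = δ t ∧
      ∀ u ∈ Set.Icc (a 0) (b 0), ∀ v ∈ Set.Icc (a 0) (b 0), u < v → δ u = δ v → u = s ∧ v = t

/-- The strands `[a i, b i]` of `γ` are simple and any two of them cross exactly once; strand `i`
passes through its crossing with strand `j` at time `x i j`. -/
structure CrossPairwiseOnce (γ : ℝ → Sphere2) {n : ℕ} (a b : Fin n → ℝ) (x : Fin n → Fin n → ℝ) :
    Prop where
  simple : ∀ i, Set.InjOn γ (Set.Icc (a i) (b i))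
  mem : ∀ i j, i ≠ j → x i j ∈ Set.Ioo (a i) (b i)
  crossing : ∀ i j, i ≠ j → γ (x i j) = γ (x j i)
  unique : ∀ i j, i ≠ j → ∀ u ∈ Set.Icc (a i) (b i), ∀ v ∈ Set.Icc (a j) (b j),
    γ u = γ v → u = x i j ∧ v = x j i

/-- A Reidemeister move of type 3: in a disc, three simple strands that cross pairwise exactly once
(and so bound a 3-gon) are replaced by three such strands with the same endpoints, where each
strand meets the other two in the opposite order. -/
def ReidemeisterIII (P Q : KnotProjection) : Prop :=
  ∃ γ δ, Parametrizes γ P.1 ∧ Parametrizes δ Q.1 ∧ ∃ a b : Fin 3 → ℝ, AgreeOffDisc γ δ a b ∧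
    ∃ x y, CrossPairwiseOnce γ a b x ∧ CrossPairwiseOnce δ a b y ∧
      ∀ i j k, i ≠ j → i ≠ k → j ≠ k → (x i j < x i k ↔ y i k < y i j)

/-- (1, 3) homotopy: the equivalence relation on knot projections, up to sphere isotopy, that is
generated by the Reidemeister moves of types 1 and 3. -/
def OneThreeHomotopic : KnotProjection → KnotProjection → Prop :=
  Relation.EqvGen fun P Q => SphereIsotopic P Q ∨ ReidemeisterI P Q ∨ ReidemeisterIII P Q

/-- The Gauss word of the knot projection with 15 double points made of a ring of seven boxes. In
box `i` two arcs, one from each side of the box, cross twice, which gives the letters `2 * i + 1`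
and `2 * i + 2`; a third arc passes through the box, and in box `0` alone it crosses one of the other
two, which gives the letter `0`. -/
def sevenBoxWord : Fin 30 → ℕ :=
  ![0, 3, 4, 1, 2, 6, 5, 4, 3, 7, 8, 5, 6, 10, 9, 8, 7, 11, 12, 9, 10, 14, 13, 12, 11, 0, 1, 2, 14,
    13]

/-! The invariant is the existence of a `RingLabelling`: the curve is cut into 21 consecutive arcs,
every double point joins arcs of one box, and in each of the seven boxes the two arcs that turn back
still meet. Such a curve has a double point, so it is not trivial; the given Gauss word admits a
labelling; and the moves of types 1 and 3 preserve its existence.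

The moves work by relabelling: each strand of the disc is put on a single arc
(`RingLabelling.replace`). This is possible because every turning arc carries a double point, its
clasp. Between two neighbouring crossings of a strand no complete turning arc can therefore occur,
so the two labels are near and their boxes differ by at most two steps. For a triangle, the three
box displacements add up to at most six steps, and to a multiple of seven, hence to zero. That
forces a configuration in which all three strands can be collected in one box without destroying a
clasp (`collectable`).

Moves are stated with their own parametrizations, so it must also be shown that two generic
immersions with the same image differ by a change of parameter of degree 1 or -1
(`exists_reparametrization`), and that labellings survive such a change. -/

/-! ### Combinatorics of arcs and boxes. -/

/-- The arcs of a curve running through a ring of seven boxes are numbered by the integers modulo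
`21`: arc `3 * i` passes through box `i`, arc `3 * i + 1` enters box `i + 1` and turns back, and arc
`3 * i + 2` enters box `i` and turns back. This is three times the number of the box that contains
the arc `n`. -/
def arcBox (n : ℤ) : ℤ := if n % 3 = 1 then n + 2 else if n % 3 = 2 then n - 2 else n

/-- The arcs `p` and `q` lie in the same box. -/
def SameBox (p q : ℤ) : Prop := (21 : ℤ) ∣ arcBox p - arcBox q

/-- `p` and `q` are the two arcs of one box that turn back in the box. -/
def ClaspArcs (p q : ℤ) : Prop := p % 3 = 1 ∧ (21 : ℤ) ∣ q - p - 4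

/-- No arc that turns back lies strictly between the arcs `p` and `q`. -/
def NearArcs (p q : ℤ) : Prop := ∀ d : ℤ, p < d ∧ d < q ∨ q < d ∧ d < p → d % 3 = 0

lemma SameBox.symm {p q : ℤ} (h : SameBox p q) : SameBox q p := by
  unfold SameBox at *
  omega

lemma SameBox.trans {p q r : ℤ} (h : SameBox p q) (h' : SameBox q r) : SameBox p r := by
  unfold SameBox at *
  omega

lemma NearArcs.symm {p q : ℤ} (h : NearArcs p q) : NearArcs q p := fun d hd => h d hd.symm

lemma NearArcs.cases {p q : ℤ} (h : NearArcs p q) :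
    p = q ∨ q = p + 1 ∨ q = p - 1 ∨ (q = p + 2 ∧ p % 3 = 2) ∨ (q = p - 2 ∧ p % 3 = 1) := by
  have h1 := h (p + 1)
  have h2 := h (p + 2)
  have h3 := h (p - 1)
  have h4 := h (p - 2)
  omega

/-- Near but distinct arcs differ by one or two boxes, which is never a multiple of seven. -/
lemma SameBox.exists_between {p q : ℤ} (h : SameBox p q) (hpq : p < q) :
    ∃ d, p < d ∧ d < q ∧ d % 3 ≠ 0 := by
  by_contra! hd
  have hn : NearArcs p q := fun d hd' => hd d (by omega) (by omega)
  have := hn.cases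
  unfold SameBox arcBox at h
  split_ifs at h <;> omega

lemma NearArcs.arcBox_sub {p q : ℤ} (h : NearArcs p q) :
    p = q ∨ ((q = p + 1 ∨ q = p - 1) ∧ (arcBox q - arcBox p = 3 ∨ arcBox q - arcBox p = -3)) ∨
      (q = p + 2 ∧ p % 3 = 2 ∧ arcBox q - arcBox p = 6) ∨
      (q = p - 2 ∧ p % 3 = 1 ∧ arcBox q - arcBox p = -6) := by
  have := h.cases
  unfold arcBox
  split_ifs <;> omega

/-- Arcs near to the two clasp arcs of one box, but different from them, lie in different boxes. -/
lemma ClaspArcs.eq_of_near {p q p' q' : ℤ} (h : ClaspArcs p p') (hpq : NearArcs p q)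
    (hpq' : NearArcs p' q') (hs : SameBox q q') : p = q ∧ p' = q' := by
  obtain ⟨h1, h2⟩ := h
  have c1 := hpq.cases
  have c2 := hpq'.cases
  unfold SameBox arcBox at hs
  split_ifs at hs <;> omega

/-- With `m = 3 * i` and `p = m + 1`, the clasp lies in box `i + 1`, and the arcs near `q` lie in
boxes `i + 1`, `i + 2`, `i + 3`, never in box `i`. The case `p = m - 1` is the mirror image. -/
lemma ClaspArcs.not_sameBox_of_near {m p q r : ℤ} (hm : m % 3 = 0) (hp : p = m + 1 ∨ p = m - 1)
    (h : ClaspArcs p q ∨ ClaspArcs q p) (hqr : NearArcs q r) : ¬ SameBox m r := by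
  intro hs
  unfold ClaspArcs at h
  have c1 := hqr.cases
  unfold SameBox arcBox at hs
  split_ifs at hs <;> omega

/-- `r₁`, `r₂` can replace the labels `p`, `q` of a crossing without loss of a clasp. -/
def KeepsClasp (p q r₁ r₂ : ℤ) : Prop := ClaspArcs p q ∨ ClaspArcs q p → r₁ = p ∧ r₂ = q

lemma KeepsClasp.symm {p q r₁ r₂ : ℤ} (h : KeepsClasp p q r₁ r₂) : KeepsClasp q p r₂ r₁ :=
  fun hc => (h hc.symm).symm

/-- Three strands cross pairwise, strand `i` passing through its crossing with strand `j` on the arc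
`pij`. If the two arcs of each strand are near, each strand can be moved to a single arc, all in
one box, without loss of a clasp. -/
def Collectable (p01 p02 p10 p12 p20 p21 : ℤ) : Prop :=
  ∃ n0 n1 n2 : ℤ, (min p01 p02 ≤ n0 ∧ n0 ≤ max p01 p02) ∧ (min p10 p12 ≤ n1 ∧ n1 ≤ max p10 p12) ∧
    (min p20 p21 ≤ n2 ∧ n2 ≤ max p20 p21) ∧ SameBox n0 n1 ∧ SameBox n0 n2 ∧ SameBox n1 n2 ∧
    KeepsClasp p01 p10 n0 n1 ∧ KeepsClasp p02 p20 n0 n2 ∧ KeepsClasp p12 p21 n1 n2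

lemma Collectable.rotate {p01 p02 p10 p12 p20 p21 : ℤ}
    (h : Collectable p01 p02 p10 p12 p20 p21) : Collectable p21 p20 p12 p10 p02 p01 := by
  obtain ⟨n0, n1, n2, h0, h1, h2, s1, s2, s3, k1, k2, k3⟩ := h
  exact ⟨n2, n1, n0, by rwa [min_comm, max_comm], by rwa [min_comm, max_comm],
    by rwa [min_comm, max_comm], s3.symm, s2.symm, s1.symm, k3.symm, k2.symm, k1.symm⟩

lemma Collectable.swap {p01 p02 p10 p12 p20 p21 : ℤ}
    (h : Collectable p01 p02 p10 p12 p20 p21) : Collectable p10 p12 p01 p02 p21 p20 := by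
  obtain ⟨n0, n1, n2, h0, h1, h2, s1, s2, s3, k1, k2, k3⟩ := h
  exact ⟨n1, n0, n2, h1, h0, by rwa [min_comm, max_comm], s1.symm, s3, s2, k1.symm, k3, k2⟩

/-- Strand 0 stays on its arc and the other two move to their crossings with it. Only a clasp
between strands 1 and 2 could suffer, but the two arcs of a clasp lead out of their box in opposite
directions, so in that case nothing has moved. -/
lemma collectable_of_eq {p01 p02 p10 p12 p20 p21 : ℤ} (s01 : SameBox p01 p10)
    (s02 : SameBox p02 p20) (h1 : NearArcs p10 p12) (h2 : NearArcs p20 p21) (h : p01 = p02) : Collectable p01 p02 p10 p12 p20 p21 := by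
  subst h
  have hs : SameBox p10 p20 := s01.symm.trans s02
  refine ⟨p01, p10, p20, ⟨by simp, by simp⟩, ⟨by simp, by simp⟩, ⟨by simp, by simp⟩, s01, s02, hs,
    fun _ => ⟨rfl, rfl⟩, fun _ => ⟨rfl, rfl⟩, ?_⟩
  rintro (hc | hc)
  · have := hc.eq_of_near h1.symm h2.symm hs
    exact ⟨this.1.symm, this.2.symm⟩
  · have := hc.eq_of_near h2.symm h1.symm hs.symm
    exact ⟨this.2.symm, this.1.symm⟩

/-- Strand 0 skips over the passing arc `m`, and the other two strands cross in the box of `m`. All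
three move there; the crossings that are left behind cannot be clasps. -/
lemma collectable_of_mid {m p01 p02 p10 p12 p20 p21 : ℤ} (s12 : SameBox p12 p21)
    (h1 : NearArcs p10 p12) (h2 : NearArcs p20 p21) (hm : m % 3 = 0)
    (h : p01 = m + 1 ∧ p02 = m - 1 ∨ p01 = m - 1 ∧ p02 = m + 1) (hs : SameBox m p12) :
    Collectable p01 p02 p10 p12 p20 p21 := by
  refine ⟨m, p12, p21, ⟨?_, ?_⟩, ⟨by simp, by simp⟩, ⟨by simp, by simp⟩, hs, hs.trans s12, s12,
    fun hc => ?_, fun hc => ?_, fun _ => ⟨rfl, rfl⟩⟩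
  · rw [min_le_iff]; omega
  · rw [le_max_iff]; omega
  · exact absurd hs (ClaspArcs.not_sameBox_of_near hm (by omega) hc h1)
  · exact absurd (hs.trans s12) (ClaspArcs.not_sameBox_of_near hm (by omega) hc h2)

/-- A displacement of two boxes on strand 0 can only be cancelled modulo seven by two displacements
of one box each, so strands 1 and 2 cross in the box halfway. -/
lemma collectable_of_two {p01 p02 p10 p12 p20 p21 : ℤ} (s01 : SameBox p01 p10)
    (s02 : SameBox p02 p20) (s12 : SameBox p12 p21) (h1 : NearArcs p10 p12)
    (h2 : NearArcs p20 p21) (n1 : p10 ≠ p12) (n2 : p20 ≠ p21)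
    (h : p02 = p01 + 2 ∧ p01 % 3 = 2 ∧ arcBox p02 - arcBox p01 = 6 ∨
      p02 = p01 - 2 ∧ p01 % 3 = 1 ∧ arcBox p02 - arcBox p01 = -6) :
    Collectable p01 p02 p10 p12 p20 p21 := by
  have d1 := h1.arcBox_sub
  have d2 := h2.arcBox_sub
  rcases h with ⟨e, hm, hd⟩ | ⟨e, hm, hd⟩
  · refine collectable_of_mid (m := p01 + 1) s12 h1 h2 (by omega) (by omega) ?_
    have e1 : arcBox p01 = p01 - 2 := by unfold arcBox; split_ifs <;> omega
    have e2 : arcBox (p01 + 1) = p01 + 1 := by unfold arcBox; split_ifs <;> omega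
    unfold SameBox at *
    omega
  · refine collectable_of_mid (m := p01 - 1) s12 h1 h2 (by omega) (by omega) ?_
    have e1 : arcBox p01 = p01 + 2 := by unfold arcBox; split_ifs; omega
    have e2 : arcBox (p01 - 1) = p01 - 1 := by unfold arcBox; split_ifs <;> omega
    unfold SameBox at *
    omega

/-- If no strand has equal labels, the displacements are one or two boxes each; since they sum to
zero modulo seven, at least one of them is two boxes. -/
lemma collectable {p01 p02 p10 p12 p20 p21 : ℤ} (s01 : SameBox p01 p10)
    (s02 : SameBox p02 p20) (s12 : SameBox p12 p21) (h0 : NearArcs p01 p02) (h1 : NearArcs p10 p12)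
    (h2 : NearArcs p20 p21) : Collectable p01 p02 p10 p12 p20 p21 := by
  by_cases e0 : p01 = p02
  · exact collectable_of_eq s01 s02 h1 h2 e0
  by_cases e1 : p10 = p12
  · exact (collectable_of_eq s01.symm s12 h0 h2.symm e1).swap
  by_cases e2 : p20 = p21
  · exact (collectable_of_eq s12.symm s02.symm h1.symm h0.symm e2.symm).rotate
  rcases h0.arcBox_sub with d0 | d0 | d0
  · exact absurd d0 e0
  · rcases h1.arcBox_sub with d1 | d1 | d1
    · exact absurd d1 e1
    · rcases h2.symm.arcBox_sub with d2 | d2 | d2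
      · exact absurd d2.symm e2
      -- Three displacements of one box sum to an odd number of absolute value at most three, which
      -- is not divisible by seven.
      · unfold SameBox at *
        omega
      · exact (collectable_of_two s12.symm s02.symm s01.symm h1.symm h0.symm (Ne.symm e1)
          (Ne.symm e0) d2).rotate
    · exact (collectable_of_two s01.symm s12 s02 h0 h2.symm e0 (Ne.symm e2) d1).swap
  · exact collectable_of_two s01 s02 s12 h1 h2 e1 e2 d0

/-! ### Labellings of a curve, and replacement of strands in a disc. -/

/-- `L` labels the times of the closed curve `γ` by consecutive arcs of the ring of seven boxes, in
such a way that double points lie inside the boxes and the two arcs that turn back in a box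
intersect. -/
structure RingLabelling (γ : ℝ → Sphere2) (L : ℝ → ℤ) : Prop where
  mono : Monotone L
  add_one : ∀ t, L (t + 1) = L t + 21
  sameBox : ∀ s t, γ s = γ t → SameBox (L s) (L t)
  clasp : ∀ n : ℤ, n % 3 = 1 → ∃ s t, γ s = γ t ∧ L s = n ∧ L t = n + 4

lemma map_add_int_of_add_one {R : Type*} [CommRing R] {L : ℝ → R} {c : R}
    (h : ∀ t, L (t + 1) = L t + c) (t : ℝ) (m : ℤ) : L (t + m) = L t + c * m := by
  induction m using Int.induction_on with
  | zero => simp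
  | succ k ih =>
    have := h (t + (k : ℤ))
    push_cast at *
    rw [← add_assoc, this, ih]
    ring
  | pred k ih =>
    have := h (t + (-(k : ℤ) - 1 : ℤ))
    push_cast at *
    rw [show t + (-(k : ℝ) - 1) + 1 = t + -(k : ℝ) by ring, ih] at this
    linear_combination -this

namespace RingLabelling

variable {γ : ℝ → Sphere2} {L : ℝ → ℤ}

lemma add_int (h : RingLabelling γ L) (t : ℝ) (m : ℤ) : L (t + m) = L t + 21 * m :=
  map_add_int_of_add_one h.add_one t m

lemma exists_double (h : RingLabelling γ L) {d : ℤ} (hd : d % 3 ≠ 0) :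
    ∃ u v, γ u = γ v ∧ L u = d ∧ ¬ (21 : ℤ) ∣ L v - d := by
  rcases (by omega : d % 3 = 1 ∨ (d - 4) % 3 = 1) with h1 | h1
  · obtain ⟨s, t, e, hs, ht⟩ := h.clasp _ h1
    exact ⟨s, t, e, hs, by omega⟩
  · obtain ⟨s, t, e, hs, ht⟩ := h.clasp _ h1
    exact ⟨t, s, e.symm, by omega, by omega⟩

lemma not_injOn (h : RingLabelling γ L) (hγ : Function.Periodic γ 1) :
    ¬ Set.InjOn γ (Set.Ico 0 1) := by
  intro hi
  obtain ⟨s, t, e, hs, ht⟩ := h.clasp 1 rfl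
  have key : ∀ r : ℝ, γ (Int.fract r) = γ r := fun r => by
    have := hγ.sub_int_mul_eq ⌊r⌋ (x := r)
    rwa [mul_one, Int.self_sub_floor] at this
  have hf : Int.fract s = Int.fract t := hi ⟨Int.fract_nonneg _, Int.fract_lt_one _⟩
    ⟨Int.fract_nonneg _, Int.fract_lt_one _⟩ (by rw [key, key, e])
  obtain ⟨m, hm⟩ := Int.fract_eq_fract.1 hf
  have := h.add_int t m
  rw [← hm, add_sub_cancel] at this
  omega

end RingLabelling

namespace HasStrands

variable {γ : ℝ → Sphere2} {D : Set Sphere2} {k : ℕ} {a b : Fin k → ℝ}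

lemma unique (h : HasStrands γ D a b) {t : ℝ} {i j : Fin k} {m m' : ℤ}
    (h1 : t + m ∈ Set.Ioo (a i) (b i)) (h2 : t + m' ∈ Set.Ioo (a j) (b j)) : i = j ∧ m = m' := by
  have e1 := h.within_turn i j
  have e2 := h.within_turn j i
  obtain ⟨h1, h1'⟩ := h1
  obtain ⟨h2, h2'⟩ := h2
  have l1 : (m : ℝ) < m' + 2 := by linarith
  have hm : m = m' := by
    have g1 : (m : ℝ) < ((m' + 2 : ℤ) : ℝ) := by push_cast; linarith
    have g2 : (m' : ℝ) < ((m + 2 : ℤ) : ℝ) := by push_cast; linarith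
    have g1' := Int.cast_lt.1 g1
    have g2' := Int.cast_lt.1 g2
    by_contra hne
    rcases lt_or_gt_of_ne hne with hlt | hgt
    · have : (m : ℝ) + 1 ≤ m' := by exact_mod_cast hlt
      linarith [h.lt i, h.lt j]
    · have : (m' : ℝ) + 1 ≤ m := by exact_mod_cast hgt
      linarith [h.lt i, h.lt j]
  subst hm
  refine ⟨?_, rfl⟩
  rcases lt_trichotomy i j with hlt | heq | hgt
  · linarith [h.ordered i j hlt]
  · exact heq
  · linarith [h.ordered j i hgt]

/-- Two different strands, in a suitable lift, are separated. -/
lemma end_le_start (h : HasStrands γ D a b) {s t : ℝ} (hst : s ≤ t) {i j : Fin k} {m m' : ℤ}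
    (h1 : s + m ∈ Set.Ioo (a i) (b i)) (h2 : t + m' ∈ Set.Ioo (a j) (b j))
    (hne : ¬ (i = j ∧ m = m')) : b i - m ≤ a j - m' := by
  have e1 := h.within_turn i j
  have e2 := h.within_turn j i
  obtain ⟨h1, h1'⟩ := h1
  obtain ⟨h2, h2'⟩ := h2
  rcases lt_trichotomy m m' with hlt | rfl | hgt
  · have : (m : ℝ) + 1 ≤ m' := by exact_mod_cast hlt
    linarith
  · rcases lt_trichotomy i j with hlt | heq | hgt
    · linarith [h.ordered i j hlt]
    · exact absurd ⟨heq, rfl⟩ hne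
    · linarith [h.ordered j i hgt]
  · have : (m' : ℝ) + 1 ≤ m := by exact_mod_cast hgt
    linarith

/-- The new labelling is constant on each open strand and its integer translates, shifted by
multiples of 21. The bounds on `n i` keep it monotone because the translates are disjoint. -/
lemma exists_relabelling (h : HasStrands γ D a b) {L : ℝ → ℤ} (hL : Monotone L)
    (hL1 : ∀ t, L (t + 1) = L t + 21) {n : Fin k → ℤ} (hn : ∀ i, L (a i) ≤ n i ∧ n i ≤ L (b i)) :
    ∃ L' : ℝ → ℤ, Monotone L' ∧ (∀ t, L' (t + 1) = L' t + 21) ∧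
      (∀ (t : ℝ) i, ∀ m : ℤ, t + m ∈ Set.Ioo (a i) (b i) → L' t = n i - 21 * m) ∧
      ∀ t : ℝ, (∀ i, ∀ m : ℤ, t + m ∉ Set.Ioo (a i) (b i)) → L' t = L t := by
  classical
  have hex : ∀ t : ℝ, ∃ v : ℤ, (∀ i, ∀ m : ℤ, t + m ∈ Set.Ioo (a i) (b i) → v = n i - 21 * m) ∧
      ((∀ i, ∀ m : ℤ, t + m ∉ Set.Ioo (a i) (b i)) → v = L t) := by
    intro t
    by_cases ht : ∃ i, ∃ m : ℤ, t + m ∈ Set.Ioo (a i) (b i)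
    · obtain ⟨i, m, him⟩ := ht
      refine ⟨n i - 21 * m, fun j m' hj => ?_, fun hno => absurd him (hno i m)⟩
      obtain ⟨rfl, rfl⟩ := h.unique him hj
      rfl
    · push Not at ht
      exact ⟨L t, fun i m him => absurd him (ht i m), fun _ => rfl⟩
  choose L' hin hout using hex
  have hint := map_add_int_of_add_one hL1
  have hsub : ∀ (x : ℝ) (m : ℤ), L (x - m) = L x - 21 * m := fun x m => by
    have := hint x (-m)
    push_cast at this
    rw [sub_eq_add_neg, this]
    ring
  refine ⟨L', fun s t hst => ?_, fun t => ?_, hin, hout⟩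
  · by_cases hs : ∃ i, ∃ m : ℤ, s + m ∈ Set.Ioo (a i) (b i)
    · obtain ⟨i, m, him⟩ := hs
      rw [hin s i m him]
      have hb : n i - 21 * m ≤ L (b i - m) := by
        rw [hsub]
        linarith [(hn i).2]
      by_cases ht : ∃ j, ∃ m : ℤ, t + m ∈ Set.Ioo (a j) (b j)
      · obtain ⟨j, m', hjm⟩ := ht
        rw [hin t j m' hjm]
        by_cases he : i = j ∧ m = m'
        · obtain ⟨rfl, rfl⟩ := he
          rfl
        · have := hL (h.end_le_start hst him hjm he)
          rw [hsub (a j)] at this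
          linarith [(hn j).1]
      · push Not at ht
        rw [hout t ht]
        refine hb.trans (hL ?_)
        have := ht i m
        rw [Set.mem_Ioo, not_and, not_lt] at this
        linarith [this (by linarith [him.1])]
    · push Not at hs
      rw [hout s hs]
      by_cases ht : ∃ j, ∃ m : ℤ, t + m ∈ Set.Ioo (a j) (b j)
      · obtain ⟨j, m', hjm⟩ := ht
        rw [hin t j m' hjm]
        have : L s ≤ L (a j - m') := by
          refine hL ?_
          by_contra hlt
          exact hs j m' ⟨by linarith, by linarith [hjm.2]⟩
        rw [hsub] at this
        linarith [(hn j).1]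
      · push Not at ht
        rw [hout t ht]
        exact hL hst
  · by_cases ht : ∃ j, ∃ m : ℤ, t + m ∈ Set.Ioo (a j) (b j)
    · obtain ⟨j, m, hjm⟩ := ht
      rw [hin t j m hjm, hin (t + 1) j (m - 1) (by push_cast; convert hjm using 1; ring)]
      ring
    · push Not at ht
      rw [hout t ht, hout (t + 1), hL1]
      intro i m him
      refine ht i (m + 1) ?_
      push_cast
      convert him using 1
      ring

lemma not_mem_of_apply_eq (h : HasStrands γ D a b) {s t : ℝ} (hst : γ s = γ t)
    (hs : ∀ i, ∀ m : ℤ, s + m ∉ Set.Ioo (a i) (b i)) (i : Fin k) (m : ℤ) :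
    t + m ∉ Set.Ioo (a i) (b i) := by
  intro ht
  have := (h.mem_interior_iff t).2 ⟨i, m, ht⟩
  rw [← hst, h.mem_interior_iff] at this
  obtain ⟨j, m', hj⟩ := this
  exact hs j m' hj

end HasStrands

lemma AgreeOffDisc.symm {γ δ : ℝ → Sphere2} {k : ℕ} {a b : Fin k → ℝ}
    (h : AgreeOffDisc γ δ a b) : AgreeOffDisc δ γ a b := by
  obtain ⟨D, hD, hγ, hδ, heq⟩ := h
  refine ⟨D, hD, hδ, hγ, fun t ht => (heq t ?_).symm⟩
  rwa [hγ.mem_interior_iff, ← hδ.mem_interior_iff]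

/-- A labelling survives the replacement of the strands in a disc, if the strand `i` can be given
the label `n i`. -/
lemma RingLabelling.replace {γ δ : ℝ → Sphere2} {L : ℝ → ℤ} (hL : RingLabelling γ L)
    (hγ : Function.Periodic γ 1) (hδ : Function.Periodic δ 1) {k : ℕ} {a b : Fin k → ℝ}
    (hD : AgreeOffDisc γ δ a b) {n : Fin k → ℤ} (hn : ∀ i, L (a i) ≤ n i ∧ n i ≤ L (b i))
    (hbox : ∀ i j, i ≠ j → ∀ u ∈ Set.Ioo (a i) (b i), ∀ v ∈ Set.Ioo (a j) (b j), δ u = δ v →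
      SameBox (n i) (n j))
    (hclasp : ∀ i j, ∀ u ∈ Set.Ioo (a i) (b i), ∀ v ∈ Set.Ioo (a j) (b j), γ u = γ v →
      ClaspArcs (L u) (L v) → n i = L u ∧ n j = L v ∧
        ∃ u' ∈ Set.Ioo (a i) (b i), ∃ v' ∈ Set.Ioo (a j) (b j), δ u' = δ v') :
    ∃ L', RingLabelling δ L' := by
  obtain ⟨D, -, hγD, hδD, heq⟩ := hD
  obtain ⟨L', hmono, hone, hin, hout⟩ := hγD.exists_relabelling hL.mono hL.add_one hn
  have heq' : ∀ t : ℝ, (∀ i, ∀ m : ℤ, t + m ∉ Set.Ioo (a i) (b i)) → δ t = γ t := by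
    intro t ht
    refine heq t ?_
    rw [hγD.mem_interior_iff]
    push Not
    exact ht
  have pγ : ∀ (t : ℝ) (m : ℤ), γ (t + m) = γ t := fun t m => by simpa using hγ.int_mul m t
  have pδ : ∀ (t : ℝ) (m : ℤ), δ (t + m) = δ t := fun t m => by simpa using hδ.int_mul m t
  refine ⟨L', hmono, hone, fun s t hst => ?_, fun p hp => ?_⟩
  · by_cases hs : ∃ i, ∃ m : ℤ, s + m ∈ Set.Ioo (a i) (b i)
    · have hs' := (hδD.mem_interior_iff s).2 hs
      rw [hst, hδD.mem_interior_iff] at hs'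
      obtain ⟨j, m', hj⟩ := hs'
      obtain ⟨i, m, hi⟩ := hs
      rw [hin s i m hi, hin t j m' hj]
      have : SameBox (n i) (n j) := by
        by_cases hij : i = j
        · subst hij
          simp [SameBox]
        · exact hbox i j hij _ hi _ hj (by rw [pδ, pδ, hst])
      unfold SameBox arcBox at *
      have e1 : (n i - 21 * m) % 3 = n i % 3 := by omega
      have e2 : (n j - 21 * m') % 3 = n j % 3 := by omega
      rw [e1, e2]
      split_ifs at * <;> omega
    · push Not at hs
      have ht := hδD.not_mem_of_apply_eq hst hs
      rw [hout s hs, hout t ht]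
      exact hL.sameBox s t (by rw [← heq' s hs, ← heq' t ht, hst])
  · obtain ⟨s, t, hst, es, et⟩ := hL.clasp p hp
    by_cases hs : ∃ i, ∃ m : ℤ, s + m ∈ Set.Ioo (a i) (b i)
    · have hs' := (hγD.mem_interior_iff s).2 hs
      rw [hst, hγD.mem_interior_iff] at hs'
      obtain ⟨j, m', hj⟩ := hs'
      obtain ⟨i, m, hi⟩ := hs
      have e1 := hL.add_int s m
      have e2 := hL.add_int t m'
      obtain ⟨f1, f2, u, hu, v, hv, huv⟩ := hclasp i j _ hi _ hj (by rw [pγ, pγ, hst])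
        ⟨by omega, by omega⟩
      -- The translation back by `m` and `m'` makes the labels exactly `p` and `p + 4`, not merely
      -- congruent to them modulo 21.
      refine ⟨u - m, v - m', ?_, ?_, ?_⟩
      · rw [← pδ (u - m) m, ← pδ (v - m') m']
        simpa using huv
      · rw [hin (u - m) i m (by simpa using hu)]
        omega
      · rw [hin (v - m') j m' (by simpa using hv)]
        omega
    · push Not at hs
      have ht := hγD.not_mem_of_apply_eq hst hs
      exact ⟨s, t, by rw [heq' s hs, heq' t ht, hst], by rw [hout s hs, es],
        by rw [hout t ht, et]⟩

/-! ### Invariance under the moves of types 1 and 3. -/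

/-- A time strictly between two labels that carries the label of an arc that turns back. -/
lemma RingLabelling.exists_double_between {γ : ℝ → Sphere2} {L : ℝ → ℤ} (hL : RingLabelling γ L)
    (hγ : Function.Periodic γ 1) {D : Set Sphere2} {k : ℕ} {a b : Fin k → ℝ}
    (hD : HasStrands γ D a b) {i : Fin k} {s t : ℝ} (hs : s ∈ Set.Icc (a i) (b i))
    (ht : t ∈ Set.Icc (a i) (b i)) {d : ℤ} (h1 : L s < d) (h2 : d < L t) (hd : d % 3 ≠ 0) :
    ∃ u, s < u ∧ u < t ∧ ∃ j, ∃ v ∈ Set.Ioo (a j) (b j), u ≠ v ∧ γ u = γ v := by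
  obtain ⟨u, v, huv, eu, hv⟩ := hL.exists_double hd
  have hsu : s < u := by
    by_contra! hle
    have := hL.mono hle
    omega
  have hut : u < t := by
    by_contra! hle
    have := hL.mono hle
    omega
  have := (hD.mem_interior_iff u).2 ⟨i, 0, by simpa using ⟨by linarith [hs.1], by linarith [ht.2]⟩⟩
  rw [huv, hD.mem_interior_iff] at this
  obtain ⟨j, m, hj⟩ := this
  refine ⟨u, hsu, hut, j, v + m, hj, ?_, ?_⟩
  -- The two arcs of a clasp are incongruent modulo 21, so `u` and `v` are different points of the
  -- circle.
  · intro he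
    have := hL.add_int v m
    rw [← he] at this
    omega
  · rw [huv]
    simpa using (hγ.int_mul m v).symm

lemma ClaspArcs.ne {p q : ℤ} (h : ClaspArcs p q) : p ≠ q := by
  rintro rfl
  have := h.2
  omega

/-- A simple strand contains no clasp that could be lost, and the new double point has both passages
on one arc. -/
lemma RingLabelling.reidemeisterI {γ δ : ℝ → Sphere2} {a b : Fin 1 → ℝ}
    (hγ : Function.Periodic γ 1) (hδ : Function.Periodic δ 1)
    (hD : AgreeOffDisc γ δ a b) (hinj : Set.InjOn γ (Set.Icc (a 0) (b 0))) {L : ℝ → ℤ}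
    (hL : RingLabelling γ L) : ∃ L', RingLabelling δ L' := by
  obtain ⟨D, hD0, hγD, hδD, heq⟩ := id hD
  refine hL.replace hγ hδ hD (n := fun i => L (a i)) (fun i => ⟨le_rfl, hL.mono (hγD.lt i).le⟩)
    (fun i j hij => absurd (Subsingleton.elim i j) hij) fun i j u hu v hv huv hc => ?_
  fin_cases i
  fin_cases j
  have := hinj (Set.Ioo_subset_Icc_self hu) (Set.Ioo_subset_Icc_self hv) huv
  exact absurd (congrArg L this) hc.ne

lemma RingLabelling.reidemeisterI_symm {γ δ : ℝ → Sphere2} {a b : Fin 1 → ℝ}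
    (hγ : Function.Periodic γ 1) (hδ : Function.Periodic δ 1)
    (hD : AgreeOffDisc γ δ a b) {s t : ℝ} (hs : a 0 < s) (hst : s < t) (ht : t < b 0)
    (hδst : δ s = δ t) (huniq : ∀ u ∈ Set.Icc (a 0) (b 0), ∀ v ∈ Set.Icc (a 0) (b 0), u < v →
      δ u = δ v → u = s ∧ v = t) {L : ℝ → ℤ}
    (hL : RingLabelling δ L) : ∃ L', RingLabelling γ L' := by
  obtain ⟨D, hD0, hγD, hδD, heq⟩ := id hD
  have hpair : ∀ u ∈ Set.Ioo (a 0) (b 0), ∀ v ∈ Set.Ioo (a 0) (b 0), u ≠ v → δ u = δ v →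
      u = s ∨ u = t := by
    intro u hu v hv hne huv
    rcases lt_or_gt_of_ne hne with h | h
    · exact Or.inl (huniq u (Set.Ioo_subset_Icc_self hu) v (Set.Ioo_subset_Icc_self hv) h huv).1
    · exact Or.inr
        (huniq v (Set.Ioo_subset_Icc_self hv) u (Set.Ioo_subset_Icc_self hu) h huv.symm).2
  -- Otherwise a turning arc would lie strictly inside the loop, and its clasp would be a second
  -- double point of the strand.
  have hLst : L s = L t := by
    by_contra hne
    have hlt : L s < L t := lt_of_le_of_ne (hL.mono hst.le) hne
    obtain ⟨d, h1, h2, h3⟩ := (hL.sameBox s t hδst).exists_between hlt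
    obtain ⟨u, hsu, hut, j, v, hv, huv, he⟩ := hL.exists_double_between hδ hδD (i := 0)
      (s := s) (t := t) ⟨by linarith, by linarith⟩ ⟨by linarith, by linarith⟩ h1 h2 h3
    fin_cases j
    rcases hpair u ⟨by linarith, by linarith⟩ v hv huv he with h | h <;> linarith
  refine hL.replace hδ hγ hD.symm (n := fun i => L s) (fun i => ?_)
    (fun i j hij => absurd (Subsingleton.elim i j) hij) fun i j u hu v hv huv hc => ?_
  · fin_cases i
    exact ⟨hL.mono hs.le, hL.mono (hst.trans ht).le⟩
  · fin_cases i
    fin_cases j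
    have hne : u ≠ v := fun h => hc.ne (congrArg L h)
    have e1 : L u = L s := by
      rcases hpair u hu v hv hne huv with h | h <;> simp [h, hLst]
    have e2 : L v = L s := by
      rcases hpair v hv u hu hne.symm huv.symm with h | h <;> simp [h, hLst]
    exact absurd (e1.trans e2.symm) hc.ne

lemma RingLabelling.reidemeisterIII {γ δ : ℝ → Sphere2} {a b : Fin 3 → ℝ}
    (hγ : Function.Periodic γ 1) (hδ : Function.Periodic δ 1) (hD : AgreeOffDisc γ δ a b)
    {x y : Fin 3 → Fin 3 → ℝ} (hx : CrossPairwiseOnce γ a b x) (hy : CrossPairwiseOnce δ a b y)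
    {L : ℝ → ℤ} (hL : RingLabelling γ L) : ∃ L', RingLabelling δ L' := by
  obtain ⟨D, hD0, hγD, hδD, heq⟩ := id hD
  have hbox : ∀ i j, i ≠ j → SameBox (L (x i j)) (L (x j i)) := fun i j hij =>
    hL.sameBox _ _ (hx.crossing i j hij)
  have hmem : ∀ i j, i ≠ j → x i j ∈ Set.Icc (a i) (b i) := fun i j hij =>
    Set.Ioo_subset_Icc_self (hx.mem i j hij)
  -- A turning arc strictly between the two crossings would carry a third crossing of strand `i`.
  have hno : ∀ i j k, i ≠ j → i ≠ k → j ≠ k → ∀ d, L (x i j) < d → d < L (x i k) →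
      d % 3 = 0 := by
    intro i j k hij hik hjk d h1 h2
    by_contra h3
    obtain ⟨u, hsu, hut, l, v, hv, huv, he⟩ := hL.exists_double_between hγ hγD (hmem i j hij)
      (hmem i k hik) h1 h2 h3
    have hu : u ∈ Set.Icc (a i) (b i) :=
      ⟨by linarith [(hmem i j hij).1], by linarith [(hmem i k hik).2]⟩
    by_cases hil : i = l
    · subst hil
      exact huv (hx.simple i hu (Set.Ioo_subset_Icc_self hv) he)
    · have := (hx.unique i l hil u hu v (Set.Ioo_subset_Icc_self hv) he).1
      rcases (by omega : l = j ∨ l = k) with rfl | rfl <;> linarith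
  have hnear : ∀ i j k, i ≠ j → i ≠ k → j ≠ k → NearArcs (L (x i j)) (L (x i k)) := by
    intro i j k hij hik hjk d hd
    rcases hd with hd | hd
    · exact hno i j k hij hik hjk d hd.1 hd.2
    · exact hno i k j hik hij hjk.symm d hd.1 hd.2
  obtain ⟨n0, n1, n2, b0, b1, b2, s01, s02, s12, k01, k02, k12⟩ :=
    collectable (hbox 0 1 (by decide)) (hbox 0 2 (by decide)) (hbox 1 2 (by decide))
      (hnear 0 1 2 (by decide) (by decide) (by decide))
      (hnear 1 0 2 (by decide) (by decide) (by decide))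
      (hnear 2 0 1 (by decide) (by decide) (by decide))
  have hbounds : ∀ i j k n, i ≠ j → i ≠ k → (min (L (x i j)) (L (x i k)) ≤ n ∧
      n ≤ max (L (x i j)) (L (x i k))) → L (a i) ≤ n ∧ n ≤ L (b i) := by
    intro i j k n hij hik hn
    have h1 := hmem i j hij
    have h2 := hmem i k hik
    exact ⟨le_trans (le_min (hL.mono h1.1) (hL.mono h2.1)) hn.1,
      hn.2.trans (max_le (hL.mono h1.2) (hL.mono h2.2))⟩
  have hn : ∀ i j, i ≠ j → SameBox ((![n0, n1, n2] : Fin 3 → ℤ) i) ((![n0, n1, n2] : Fin 3 → ℤ) j) ∧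
      KeepsClasp (L (x i j)) (L (x j i)) ((![n0, n1, n2] : Fin 3 → ℤ) i)
        ((![n0, n1, n2] : Fin 3 → ℤ) j) := by
    intro i j hij
    fin_cases i <;> fin_cases j
    · exact absurd rfl hij
    · exact ⟨s01, k01⟩
    · exact ⟨s02, k02⟩
    · exact ⟨s01.symm, k01.symm⟩
    · exact absurd rfl hij
    · exact ⟨s12, k12⟩
    · exact ⟨s02.symm, k02.symm⟩
    · exact ⟨s12.symm, k12.symm⟩
    · exact absurd rfl hij
  refine hL.replace hγ hδ hD (n := ![n0, n1, n2]) (fun i => ?_)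
    (fun i j hij u hu v hv huv => (hn i j hij).1) fun i j u hu v hv huv hc => ?_
  · fin_cases i
    · exact hbounds 0 1 2 n0 (by decide) (by decide) b0
    · exact hbounds 1 0 2 n1 (by decide) (by decide) b1
    · exact hbounds 2 0 1 n2 (by decide) (by decide) b2
  · by_cases hij : i = j
    · subst hij
      have := hx.simple i (Set.Ioo_subset_Icc_self hu) (Set.Ioo_subset_Icc_self hv) huv
      exact absurd (congrArg L this) hc.ne
    · obtain ⟨eu, ev⟩ := hx.unique i j hij u (Set.Ioo_subset_Icc_self hu) v
        (Set.Ioo_subset_Icc_self hv) huv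
      rw [eu, ev] at hc ⊢
      obtain ⟨f1, f2⟩ := (hn i j hij).2 (Or.inl hc)
      exact ⟨f1, f2, y i j, hy.mem i j hij, y j i, hy.mem j i (Ne.symm hij), hy.crossing i j hij⟩

/-- A shift by 21 is one turn around the ring and returns to the same box. -/
lemma SameBox.add_mul {p q : ℤ} (h : SameBox p q) (m n : ℤ) :
    SameBox (p + 21 * m) (q + 21 * n) := by
  unfold SameBox arcBox at *
  rw [show (p + 21 * m) % 3 = p % 3 by omega, show (q + 21 * n) % 3 = q % 3 by omega]
  split_ifs at * <;> omega

/-! ### The labelling given by the Gauss word. -/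

/-- The arc of the ring of boxes on which the `i`-th passage through a double point lies. -/
def sevenBoxArc : Fin 30 → ℤ :=
  ![0, 1, 1, 2, 2, 4, 4, 5, 5, 7, 7, 8, 8, 10, 10, 11, 11, 13, 13, 14, 14, 16, 16, 17, 17, 19, 19,
    19, 20, 20]

/-- The increments of `sevenBoxArc`. -/
def sevenBoxStep : Fin 30 → ℤ :=
  ![0, 1, 0, 1, 0, 2, 0, 1, 0, 2, 0, 1, 0, 2, 0, 1, 0, 2, 0, 1, 0, 2, 0, 1, 0, 2, 0, 0, 1, 0]

lemma sevenBoxStep_nonneg (i : Fin 30) : 0 ≤ sevenBoxStep i := by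
  revert i
  decide

lemma sum_sevenBoxStep (j : Fin 30) :
    ∑ i, (if i ≤ j then sevenBoxStep i else 0) = sevenBoxArc j := by
  revert j
  decide +kernel

lemma sevenBoxArc_sameBox (i j : Fin 30) (h : sevenBoxWord i = sevenBoxWord j) :
    SameBox (sevenBoxArc i) (sevenBoxArc j) := by
  revert i j
  unfold SameBox
  decide +kernel

lemma sevenBoxArc_clasp (r : ℤ) (h0 : 0 ≤ r) (h1 : r < 21) (h : r % 3 = 1) :
    ∃ i j, sevenBoxWord i = sevenBoxWord j ∧ sevenBoxArc i = r ∧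
      (sevenBoxArc j = r + 4 ∨ sevenBoxArc j + 21 = r + 4) := by
  rcases (by omega : r = 1 ∨ r = 4 ∨ r = 7 ∨ r = 10 ∨ r = 13 ∨ r = 16 ∨ r = 19) with
    rfl | rfl | rfl | rfl | rfl | rfl | rfl
  -- The last clasp joins arc 19 to arc 2 of the next turn, which is why 21 is added in the
  -- statement.
  exacts [⟨1, 8, by decide⟩, ⟨5, 12, by decide⟩, ⟨9, 16, by decide⟩, ⟨13, 20, by decide⟩,
    ⟨17, 24, by decide⟩, ⟨21, 28, by decide⟩, ⟨26, 3, by decide⟩]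

lemma KnotProjection.HasGaussWord.exists_ringLabelling {P : KnotProjection}
    (hP : P.HasGaussWord sevenBoxWord) : ∃ γ, Parametrizes γ P.1 ∧ ∃ L, RingLabelling γ L := by
  obtain ⟨γ, hγ, τ, hτ, hτI, hw, hall⟩ := hP
  have key : ∀ r : ℝ, γ (Int.fract r) = γ r := fun r => by
    have := hγ.1.periodic.sub_int_mul_eq ⌊r⌋ (x := r)
    rwa [mul_one, Int.self_sub_floor] at this
  set f : ℝ → ℤ := fun t => ∑ i, (if τ i ≤ t then sevenBoxStep i else 0) with hf
  have hfτ : ∀ j, f (τ j) = sevenBoxArc j := fun j => by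
    simp only [hf, hτ.le_iff_le]
    exact sum_sevenBoxStep j
  have hfmono : Monotone f := fun s t hst => Finset.sum_le_sum fun i _ => by
    have := sevenBoxStep_nonneg i
    split_ifs with h1 h2
    · rfl
    · exact absurd (h1.trans hst) h2
    · exact this
    · rfl
  have hf0 : ∀ t, 0 ≤ f t := fun t => Finset.sum_nonneg fun i _ => by
    have := sevenBoxStep_nonneg i
    split_ifs <;> simp [this]
  -- One turn stays within the labels 0 to 20, so adding 21 at each integer time keeps the labelling
  -- monotone.
  have hf20 : ∀ t, f t ≤ 20 := fun t => by
    have : f t ≤ ∑ i, sevenBoxStep i := Finset.sum_le_sum fun i _ => by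
      have := sevenBoxStep_nonneg i
      split_ifs <;> simp [this]
    exact this.trans (by decide)
  have hLτ : ∀ j (q : ℤ), 21 * ⌊τ j + q⌋ + f (Int.fract (τ j + q)) = 21 * q + sevenBoxArc j := by
    intro j q
    have h1 : ⌊τ j⌋ = 0 := Int.floor_eq_zero_iff.2 (hτI j)
    have h2 : Int.fract (τ j) = τ j := Int.fract_eq_self.2 (hτI j)
    rw [Int.floor_add_intCast, Int.fract_add_intCast, h1, h2, hfτ]
    ring
  refine ⟨γ, hγ, fun t => 21 * ⌊t⌋ + f (Int.fract t), fun s t hst => ?_, fun t => ?_,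
    fun s t hst => ?_, fun n hn => ?_⟩
  · have hle := Int.floor_mono hst
    rcases hle.lt_or_eq with hlt | he
    · have := hf20 (Int.fract s)
      have := hf0 (Int.fract t)
      show 21 * ⌊s⌋ + f (Int.fract s) ≤ 21 * ⌊t⌋ + f (Int.fract t)
      omega
    · have : Int.fract s ≤ Int.fract t := by
        unfold Int.fract
        rw [he]
        linarith
      have := hfmono this
      show 21 * ⌊s⌋ + f (Int.fract s) ≤ 21 * ⌊t⌋ + f (Int.fract t)
      omega
  · simp only [Int.floor_add_one, Int.fract_add_one]
    ring
  · suffices SameBox (f (Int.fract s)) (f (Int.fract t)) by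
      have := this.add_mul ⌊s⌋ ⌊t⌋
      simpa only [add_comm] using this
    by_cases he : Int.fract s = Int.fract t
    · rw [he]
      simp [SameBox]
    · have hs : Int.fract s ∈ Set.Ico (0 : ℝ) 1 := ⟨Int.fract_nonneg _, Int.fract_lt_one _⟩
      have ht : Int.fract t ∈ Set.Ico (0 : ℝ) 1 := ⟨Int.fract_nonneg _, Int.fract_lt_one _⟩
      have heq : γ (Int.fract s) = γ (Int.fract t) := by rw [key, key, hst]
      obtain ⟨i, hi⟩ := hall _ hs _ ht he heq
      obtain ⟨j, hj⟩ := hall _ ht _ hs (Ne.symm he) heq.symm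
      rw [← hi, ← hj] at heq ⊢
      rw [hfτ, hfτ]
      exact sevenBoxArc_sameBox i j ((hw i j).1 heq)
  · obtain ⟨i, j, hij, hi, hj⟩ := sevenBoxArc_clasp (n % 21) (by omega) (by omega) (by omega)
    have hγij := (hw i j).2 hij
    have pγ : ∀ (t : ℝ) (m : ℤ), γ (t + m) = γ t := fun t m => by
      simpa using hγ.1.periodic.int_mul m t
    rcases hj with hj | hj
    · exact ⟨τ i + (n / 21 : ℤ), τ j + (n / 21 : ℤ), by rw [pγ, pγ, hγij],
        by rw [hLτ]; omega, by rw [hLτ]; omega⟩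
    · exact ⟨τ i + (n / 21 : ℤ), τ j + (n / 21 + 1 : ℤ), by rw [pγ, pγ, hγij],
        by rw [hLτ]; omega, by rw [hLτ]; omega⟩

/-! ### Generic immersions under diffeomorphisms of the sphere. -/

lemma IsGenericImmersion.contMDiff {γ : ℝ → Sphere2} (hγ : IsGenericImmersion γ) :
    ContMDiff 𝓘(ℝ, ℝ) (𝓡 2) ∞ γ :=
  have : Fact (Module.finrank ℝ (EuclideanSpace ℝ (Fin 3)) = 2 + 1) := ⟨by simp⟩
  ContMDiff.codRestrict_sphere (f := fun t => (γ t : EuclideanSpace ℝ (Fin 3)))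
    hγ.smooth.contMDiff (fun t => (γ t).2)

/-- A diffeomorphism of the sphere acts on velocities by injective linear maps. -/
lemma IsGenericImmersion.exists_velocity_comp {γ : ℝ → Sphere2} (hγ : IsGenericImmersion γ)
    (h : Diffeomorph (𝓡 2) (𝓡 2) Sphere2 Sphere2 ∞) :
    ∃ (w : ℝ → EuclideanSpace ℝ (Fin 2))
      (I J : Sphere2 → EuclideanSpace ℝ (Fin 2) →ₗ[ℝ] EuclideanSpace ℝ (Fin 3)),
      (∀ p, Function.Injective (I p)) ∧ (∀ p, Function.Injective (J p)) ∧
      ∀ t, velocity γ t = I (γ t) (w t) ∧ velocity (fun t => h (γ t)) t = J (γ t) (w t) := by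
  have : Fact (Module.finrank ℝ (EuclideanSpace ℝ (Fin 3)) = 2 + 1) := ⟨by simp⟩
  have hc : ∀ p : Sphere2, MDifferentiableAt (𝓡 2) 𝓘(ℝ, EuclideanSpace ℝ (Fin 3))
      ((↑) : Sphere2 → EuclideanSpace ℝ (Fin 3)) p := fun p =>
    (contMDiff_coe_sphere (m := ∞)).mdifferentiable (by simp) p
  have hg : ∀ t, MDifferentiableAt 𝓘(ℝ, ℝ) (𝓡 2) γ t := fun t =>
    hγ.contMDiff.mdifferentiable (by simp) t
  have hh : ∀ p, MDifferentiableAt (𝓡 2) (𝓡 2) h p := fun p =>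
    h.contMDiff.mdifferentiable (by simp) p
  refine ⟨fun t => mfderiv 𝓘(ℝ, ℝ) (𝓡 2) γ t (1 : ℝ),
    fun p => (mfderiv (𝓡 2) 𝓘(ℝ, EuclideanSpace ℝ (Fin 3))
      ((↑) : Sphere2 → EuclideanSpace ℝ (Fin 3)) p).toLinearMap,
    fun p => ((mfderiv (𝓡 2) 𝓘(ℝ, EuclideanSpace ℝ (Fin 3))
      ((↑) : Sphere2 → EuclideanSpace ℝ (Fin 3)) (h p)).toLinearMap).comp
        (mfderiv (𝓡 2) (𝓡 2) h p).toLinearMap,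
    fun p => injective_mvfderiv_subtypeVal_sphere p, fun p => ?_, fun t => ⟨?_, ?_⟩⟩
  · refine (injective_mvfderiv_subtypeVal_sphere (h p)).comp ?_
    exact (h.mfderivToContinuousLinearEquiv (by simp) p).injective
  · have := mfderiv_comp t (hc (γ t)) (hg t)
    rw [mfderiv_eq_fderiv] at this
    exact congrArg (fun A => A (1 : ℝ)) this
  · have h1 := mfderiv_comp t (hh (γ t)) (hg t)
    have h2 := mfderiv_comp t (hc (h (γ t))) ((hh (γ t)).comp t (hg t))
    rw [mfderiv_eq_fderiv, h1] at h2
    exact congrArg (fun A => A (1 : ℝ)) h2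

lemma IsGenericImmersion.comp_diffeomorph {γ : ℝ → Sphere2} (hγ : IsGenericImmersion γ)
    (h : Diffeomorph (𝓡 2) (𝓡 2) Sphere2 Sphere2 ∞) : IsGenericImmersion fun t => h (γ t) := by
  have : Fact (Module.finrank ℝ (EuclideanSpace ℝ (Fin 3)) = 2 + 1) := ⟨by simp⟩
  obtain ⟨w, I, J, hI, hJ, hv⟩ := hγ.exists_velocity_comp h
  refine ⟨fun t => by rw [hγ.periodic t], ?_, fun t => ?_, ?_, ?_⟩
  · exact (contMDiff_coe_sphere.comp (h.contMDiff.comp hγ.contMDiff)).contDiff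
  · have := hγ.immersed t
    rw [(hv t).1] at this
    rw [(hv t).2]
    intro h0
    refine this ?_
    rw [hJ _ (h0.trans (map_zero (J (γ t))).symm), map_zero]
  · intro r hr s hs t ht h1 h2
    exact hγ.no_triple r hr s hs t ht (h.injective h1) (h.injective h2)
  · intro s hs t ht hne hst
    have he := h.injective hst
    have := hγ.transverse s hs t ht hne he
    -- At a double point both velocities are images under the same linear map, so independence
    -- passes through the tangent plane.
    rw [(hv s).1, (hv t).1, ← he] at this
    rw [(hv s).2, (hv t).2, ← he]
    have e : ∀ A : EuclideanSpace ℝ (Fin 2) →ₗ[ℝ] EuclideanSpace ℝ (Fin 3),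
        ![A (w s), A (w t)] = A ∘ ![w s, w t] := fun A => by
      ext i
      fin_cases i <;> rfl
    rw [e] at this ⊢
    exact (LinearIndependent.of_comp _ this).map' _ (LinearMap.ker_eq_bot.2 (hJ _))

/-! ### Uniqueness of the parametrization up to a change of parameter. -/

lemma IsGenericImmersion.continuous_velocity {γ : ℝ → Sphere2} (hγ : IsGenericImmersion γ) :
    Continuous (velocity γ) :=
  hγ.smooth.continuous_deriv (by simp)

lemma IsGenericImmersion.continuous {γ : ℝ → Sphere2} (hγ : IsGenericImmersion γ) :
    Continuous γ :=
  continuous_induced_rng.2 hγ.smooth.continuous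

lemma IsGenericImmersion.hasDerivAt {γ : ℝ → Sphere2} (hγ : IsGenericImmersion γ) (t : ℝ) :
    HasDerivAt (fun t => (γ t : EuclideanSpace ℝ (Fin 3))) (velocity γ t) t :=
  (hγ.smooth.differentiable (by simp) t).hasDerivAt

lemma IsGenericImmersion.apply_add_int {γ : ℝ → Sphere2} (hγ : IsGenericImmersion γ) (t : ℝ)
    (m : ℤ) : γ (t + m) = γ t := by
  simpa using hγ.periodic.int_mul m t

lemma IsGenericImmersion.velocity_add_int {γ : ℝ → Sphere2} (hγ : IsGenericImmersion γ) (t : ℝ)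
    (m : ℤ) : velocity γ (t + m) = velocity γ t := by
  have := deriv_comp_add_const (fun t => (γ t : EuclideanSpace ℝ (Fin 3))) (m : ℝ) t
  simp only [hγ.apply_add_int] at this
  exact this.symm

/-- At the times `t` and `u` the curves `δ` and `γ` are tangent to each other. -/
def TangentAt (δ γ : ℝ → Sphere2) (t u : ℝ) : Prop :=
  δ t = γ u ∧ ‖velocity γ u‖ ^ 2 • velocity δ t =
    inner ℝ (velocity γ u) (velocity δ t) • velocity γ u

variable {γ δ : ℝ → Sphere2}

lemma TangentAt.exists_smul {t u : ℝ} (h : TangentAt δ γ t u) (hγ : IsGenericImmersion γ)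
    (hδ : IsGenericImmersion δ) : ∃ c : ℝ, c ≠ 0 ∧ velocity δ t = c • velocity γ u := by
  have hne : ‖velocity γ u‖ ^ 2 ≠ 0 := pow_ne_zero 2 (norm_ne_zero_iff.2 (hγ.immersed u))
  have e : velocity δ t = ((‖velocity γ u‖ ^ 2)⁻¹ * inner ℝ (velocity γ u) (velocity δ t)) •
      velocity γ u := by
    rw [mul_smul, ← h.2, smul_smul, inv_mul_cancel₀ hne, one_smul]
  refine ⟨_, fun h0 => hδ.immersed t ?_, e⟩
  rw [e, h0, zero_smul]

lemma tangentAt_of_smul {t u c : ℝ} (h : δ t = γ u) (hv : velocity δ t = c • velocity γ u) :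
    TangentAt δ γ t u := by
  refine ⟨h, ?_⟩
  rw [hv, inner_smul_right, real_inner_self_eq_norm_sq, smul_smul, mul_comm]

lemma TangentAt.symm {t u : ℝ} (h : TangentAt δ γ t u) (hγ : IsGenericImmersion γ)
    (hδ : IsGenericImmersion δ) : TangentAt γ δ u t := by
  obtain ⟨c, hc, e⟩ := h.exists_smul hγ hδ
  exact tangentAt_of_smul (c := c⁻¹) h.1.symm (by rw [e, smul_smul, inv_mul_cancel₀ hc, one_smul])

lemma TangentAt.add_int {t u : ℝ} (h : TangentAt δ γ t u) (hγ : IsGenericImmersion γ)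
    (hδ : IsGenericImmersion δ) (m n : ℤ) : TangentAt δ γ (t + m) (u + n) := by
  unfold TangentAt
  rw [hδ.apply_add_int, hγ.apply_add_int, hδ.velocity_add_int, hγ.velocity_add_int]
  exact h

/-- Two different branches of `γ` through one point are transverse, so `δ` can be tangent to only
one of them. -/
lemma TangentAt.exists_int {t u u' : ℝ} (h : TangentAt δ γ t u) (h' : TangentAt δ γ t u')
    (hγ : IsGenericImmersion γ) (hδ : IsGenericImmersion δ) : ∃ m : ℤ, u' - u = m := by
  by_contra hno
  have hf : ∀ x : ℝ, x + (-⌊x⌋ : ℤ) = Int.fract x := fun x => by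
    push_cast
    rw [← sub_eq_add_neg, Int.self_sub_floor]
  have g := h.add_int hγ hδ 0 (-⌊u⌋)
  have g' := h'.add_int hγ hδ 0 (-⌊u'⌋)
  rw [hf] at g g'
  have hne : Int.fract u ≠ Int.fract u' := fun he =>
    hno (by obtain ⟨z, hz⟩ := Int.fract_eq_fract.1 he.symm; exact ⟨z, hz⟩)
  have hli := hγ.transverse _ ⟨Int.fract_nonneg u, Int.fract_lt_one u⟩ _
    ⟨Int.fract_nonneg u', Int.fract_lt_one u'⟩ hne (g.1.symm.trans g'.1)
  obtain ⟨c, hc, e⟩ := g.exists_smul hγ hδ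
  obtain ⟨c', hc', e'⟩ := g'.exists_smul hγ hδ
  rw [LinearIndependent.pair_iff] at hli
  exact hc (hli c (-c') (by rw [← e, neg_smul, ← e', add_neg_cancel])).1

/-- Parallelism is expressed in `TangentAt` by an equation between continuous expressions rather
than by the existence of a scalar, so it passes to limits. -/
lemma isClosed_tangentAt (hγ : IsGenericImmersion γ) (hδ : IsGenericImmersion δ) :
    IsClosed {p : ℝ × ℝ | TangentAt δ γ p.1 p.2} := by
  have h1 := hγ.continuous.comp (continuous_snd (X := ℝ) (Y := ℝ))
  have h2 := hδ.continuous.comp (continuous_fst (X := ℝ) (Y := ℝ))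
  have h3 := hγ.continuous_velocity.comp (continuous_snd (X := ℝ) (Y := ℝ))
  have h4 := hδ.continuous_velocity.comp (continuous_fst (X := ℝ) (Y := ℝ))
  exact (isClosed_eq h2 h1).inter (isClosed_eq ((h3.norm.pow 2).smul h4) ((h3.inner (𝕜 := ℝ) h4).smul h3))

open Filter Topology in
/-- If the image of `δ` is contained in the image of `γ`, each point of `δ` lies on a branch of `γ`
that is tangent to `δ`. -/
lemma exists_tangentAt (hγ : IsGenericImmersion γ) (hδ : IsGenericImmersion δ)
    (h : Set.range δ ⊆ Set.range γ) (t : ℝ) : ∃ u ∈ Set.Icc (0 : ℝ) 1, TangentAt δ γ t u := by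
  have hex : ∀ s, ∃ u ∈ Set.Icc (0 : ℝ) 1, γ u = δ s := fun s => by
    obtain ⟨u, hu⟩ := h ⟨s, rfl⟩
    refine ⟨Int.fract u, ⟨Int.fract_nonneg u, (Int.fract_lt_one u).le⟩, ?_⟩
    have := hγ.apply_add_int u (-⌊u⌋)
    push_cast at this
    rwa [← sub_eq_add_neg, Int.self_sub_floor, hu] at this
  choose f hf hγf using hex
  -- Nearby points of `δ` lie on `γ` at arbitrarily chosen parameters; compactness extracts a limit
  -- `u`, the parameter of the tangent branch.
  have ht : Tendsto (fun n : ℕ => t + 1 / ((n : ℝ) + 1)) atTop (𝓝 t) := by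
    simpa using (tendsto_const_nhds (x := t)).add
      (tendsto_one_div_add_atTop_nhds_zero_nat (𝕜 := ℝ))
  obtain ⟨u, hu, k, hk, hlim⟩ := isCompact_Icc.tendsto_subseq
    (x := fun n : ℕ => f (t + 1 / ((n : ℝ) + 1))) (fun n => hf _)
  have ht' := ht.comp hk.tendsto_atTop
  have hγδ : δ t = γ u := by
    refine tendsto_nhds_unique ((hδ.continuous.tendsto t).comp ht') ?_
    refine ((hγ.continuous.tendsto u).comp hlim).congr fun n => ?_
    exact hγf _
  refine ⟨u, hu, ?_⟩
  have hslope : ∀ {γ : ℝ → Sphere2}, IsGenericImmersion γ → ∀ (t : ℝ) {x : ℕ → ℝ},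
      Tendsto x atTop (𝓝 t) → Tendsto (fun n =>
        dslope (fun t => (γ t : EuclideanSpace ℝ (Fin 3))) t (x n)) atTop (𝓝 (velocity γ t)) := by
    intro γ hγ t x hx
    have := (continuousAt_dslope_same.2 (hγ.hasDerivAt t).differentiableAt).tendsto.comp hx
    rwa [dslope_same] at this
  have s1 := hslope hδ t ht'
  have s2 := hslope hγ u hlim
  set A := fun n : ℕ => dslope (fun t => (δ t : EuclideanSpace ℝ (Fin 3))) t
    ((fun n : ℕ => t + 1 / ((n : ℝ) + 1)) (k n))
  set B := fun n : ℕ => dslope (fun t => (γ t : EuclideanSpace ℝ (Fin 3))) u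
    (f (t + 1 / ((k n : ℝ) + 1)))
  -- Both slopes are taken along the same chord, hence are parallel; using `dslope` covers the case
  -- that the parameter on `γ` equals `u`.
  have hAB : ∀ n, ∃ c : ℝ, A n = c • B n := by
    intro n
    set x := t + 1 / ((k n : ℝ) + 1) with hx
    have hpos : (0 : ℝ) < x - t := by
      rw [hx, add_sub_cancel_left]
      positivity
    have e1 : (x - t) • A n = (δ x : EuclideanSpace ℝ (Fin 3)) - δ t := sub_smul_dslope _ _ _
    have e2 : (f x - u) • B n = (γ (f x) : EuclideanSpace ℝ (Fin 3)) - γ u :=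
      sub_smul_dslope _ _ _
    refine ⟨(x - t)⁻¹ * (f x - u), ?_⟩
    rw [mul_smul, e2, hγf, ← hγδ, ← e1, smul_smul, inv_mul_cancel₀ hpos.ne', one_smul]
  refine ⟨hγδ, tendsto_nhds_unique ((s2.norm.pow 2).smul s1) ?_⟩
  refine ((s2.inner s1).smul s2).congr fun n => ?_
  obtain ⟨c, hc⟩ := hAB n
  show inner ℝ (B n) (A n) • B n = ‖B n‖ ^ 2 • A n
  rw [hc, inner_smul_right, real_inner_self_eq_norm_sq, smul_smul, mul_comm]

lemma exists_int_of_continuous {f : ℝ → ℝ} (hf : Continuous f) (h : ∀ t, ∃ m : ℤ, f t = m) :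
    ∃ m : ℤ, ∀ t, f t = m := by
  choose g hg using h
  have hgc : Continuous g := by
    rw [Int.isClosedEmbedding_coe_real.isInducing.continuous_iff]
    exact hf.congr hg
  exact ⟨g 0, fun t => by rw [hg t, PreconnectedSpace.constant inferInstance hgc (x := t) (y := 0)]⟩

lemma coe_addCircle_one_eq_iff {x y : ℝ} :
    (x : AddCircle (1 : ℝ)) = y ↔ ∃ m : ℤ, x - y = m := by
  rw [← sub_eq_zero, ← AddCircle.coe_sub, AddCircle.coe_eq_zero_iff]
  simp [eq_comm]

open Filter Topology in
/-- A continuous lift of the change of parameter between two curves with the same image. -/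
lemma exists_continuous_tangentAt (hγ : IsGenericImmersion γ) (hδ : IsGenericImmersion δ)
    (h : Set.range δ ⊆ Set.range γ) : ∃ φ : ℝ → ℝ, Continuous φ ∧ ∀ t, TangentAt δ γ t (φ t) := by
  choose f hf hT using exists_tangentAt hγ hδ h
  -- The choice `f` may jump, but modulo 1 it is determined by tangency, so compactness and
  -- closedness give continuity into the circle, and the covering ℝ → ℝ/ℤ provides a lift.
  have hcont : Continuous fun t => (f t : AddCircle (1 : ℝ)) := by
    rw [continuous_iff_seqContinuous]
    intro x t hx
    refine tendsto_of_subseq_tendsto fun ns hns => ?_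
    obtain ⟨u, hu, k, hk, hlim⟩ := isCompact_Icc.tendsto_subseq
      (x := fun n : ℕ => f (x (ns n))) (fun n => hf _)
    refine ⟨k, ?_⟩
    have hu' : TangentAt δ γ t u := by
      refine (isClosed_tangentAt hγ hδ).mem_of_tendsto
        (((hx.comp hns).comp hk.tendsto_atTop).prodMk_nhds hlim) (Eventually.of_forall fun n => ?_)
      exact hT _
    obtain ⟨m, hm⟩ := (hT t).exists_int hu' hγ hδ
    have e : (u : AddCircle (1 : ℝ)) = f t := coe_addCircle_one_eq_iff.2 ⟨m, hm⟩
    show Tendsto _ _ (𝓝 (f t : AddCircle (1 : ℝ)))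
    rw [← e]
    exact ((AddCircle.continuous_mk' (1 : ℝ)).tendsto u).comp hlim
  obtain ⟨φ, ⟨-, hφ⟩, -⟩ := (AddCircle.isCoveringMap_coe (1 : ℝ)).existsUnique_continuousMap_lifts
    ⟨_, hcont⟩ 0 (f 0) rfl
  refine ⟨φ, φ.continuous, fun t => ?_⟩
  have : ((φ t : ℝ) : AddCircle (1 : ℝ)) = (f t : AddCircle (1 : ℝ)) := congrFun hφ t
  obtain ⟨m, hm⟩ := coe_addCircle_one_eq_iff.1 this
  rw [← sub_add_cancel (φ t) (f t), hm, add_comm]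
  simpa using (hT t).add_int hγ hδ 0 m

lemma exists_add_one_of_tangentAt (hγ : IsGenericImmersion γ) (hδ : IsGenericImmersion δ)
    {φ : ℝ → ℝ} (hφ : Continuous φ) (h : ∀ t, TangentAt δ γ t (φ t)) :
    ∃ d : ℤ, ∀ t, φ (t + 1) = φ t + d := by
  obtain ⟨d, hd⟩ := exists_int_of_continuous (f := fun t => φ (t + 1) - φ t) (by fun_prop)
    fun t => (h t).exists_int (by simpa using (h (t + 1)).add_int hγ hδ (-1) 0) hγ hδ
  exact ⟨d, fun t => by linarith [hd t]⟩

/-- Two generic immersions with the same image differ by a change of parameter. -/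
lemma exists_reparametrization (hγ : IsGenericImmersion γ) (hδ : IsGenericImmersion δ)
    (h : Set.range δ = Set.range γ) : ∃ φ : ℝ → ℝ, (∀ t, δ t = γ (φ t)) ∧ Function.Surjective φ ∧
      (Monotone φ ∧ (∀ t, φ (t + 1) = φ t + 1) ∨ Antitone φ ∧ ∀ t, φ (t + 1) = φ t - 1) := by
  obtain ⟨φ, hφ, hφT⟩ := exists_continuous_tangentAt hγ hδ h.subset
  obtain ⟨ψ, hψ, hψT⟩ := exists_continuous_tangentAt hδ hγ h.symm.subset
  obtain ⟨d, hd⟩ := exists_add_one_of_tangentAt hγ hδ hφ hφT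
  obtain ⟨e, he⟩ := exists_add_one_of_tangentAt hδ hγ hψ hψT
  obtain ⟨k, hk⟩ := exists_int_of_continuous (f := fun t => ψ (φ t) - t) (by fun_prop)
    fun t => ((hφT t).symm hγ hδ).exists_int (hψT (φ t)) hδ hγ
  obtain ⟨l, hl⟩ := exists_int_of_continuous (f := fun t => φ (ψ t) - t) (by fun_prop)
    fun t => ((hψT t).symm hδ hγ).exists_int (hφT (ψ t)) hγ hδ
  -- The composite `ψ ∘ φ` is a translation, so the degrees of `φ` and `ψ` are inverse integers.
  have hed : e * d = 1 := by
    have h1 := hk 0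
    have h2 := hk (0 + 1)
    rw [hd 0, map_add_int_of_add_one he] at h2
    have : (e : ℝ) * d = 1 := by linarith
    exact_mod_cast this
  have hinj : Function.Injective φ := fun s t hst => by
    have h1 := hk s
    have h2 := hk t
    simp only [hst] at h1
    linarith
  have hsurj : Function.Surjective φ := fun t => ⟨ψ (t - l), by linarith [hl (t - l)]⟩
  refine ⟨φ, fun t => (hφT t).1, hsurj, ?_⟩
  rcases Int.eq_one_or_neg_one_of_mul_eq_one' hed with ⟨-, rfl⟩ | ⟨-, rfl⟩
  · have h1 : ∀ t, φ (t + 1) = φ t + 1 := fun t => by simpa using hd t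
    refine Or.inl ⟨?_, h1⟩
    rcases hφ.strictMono_of_inj hinj with hm | hm
    · exact hm.monotone
    · linarith [h1 0, hm (show (0 : ℝ) < 0 + 1 by norm_num)]
  · have h1 : ∀ t, φ (t + 1) = φ t - 1 := fun t => by simpa [sub_eq_add_neg] using hd t
    refine Or.inr ⟨?_, h1⟩
    rcases hφ.strictMono_of_inj hinj with hm | hm
    · linarith [h1 0, hm (show (0 : ℝ) < 0 + 1 by norm_num)]
    · exact hm.antitone

lemma RingLabelling.reparametrize {L : ℝ → ℤ} (hL : RingLabelling γ L)
    (hγ : IsGenericImmersion γ) (hδ : IsGenericImmersion δ) (h : Set.range δ = Set.range γ) :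
    ∃ L', RingLabelling δ L' := by
  obtain ⟨φ, hφ, hsurj, ⟨hm, h1⟩ | ⟨hm, h1⟩⟩ := exists_reparametrization hγ hδ h
  · refine ⟨fun t => L (φ t), hL.mono.comp hm, fun t => by rw [h1, hL.add_one], fun s t hst => ?_,
      fun n hn => ?_⟩
    · exact hL.sameBox _ _ (by rw [← hφ, ← hφ, hst])
    · obtain ⟨s, t, hst, es, et⟩ := hL.clasp n hn
      obtain ⟨s, rfl⟩ := hsurj s
      obtain ⟨t, rfl⟩ := hsurj t
      exact ⟨s, t, by rw [hφ, hφ, hst], es, et⟩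
  -- Reversing the direction negates the labels: `arcBox` is odd, so boxes are preserved, while the
  -- two turning arcs of a box exchange their roles.
  · refine ⟨fun t => -L (φ t), fun s t hst => neg_le_neg (hL.mono (hm hst)), fun t => ?_,
      fun s t hst => ?_, fun n hn => ?_⟩
    · have := hL.add_one (φ (t + 1))
      rw [h1, sub_add_cancel] at this
      rw [h1, this]
      ring
    · have := hL.sameBox (φ s) (φ t) (by rw [← hφ, ← hφ, hst])
      unfold SameBox arcBox at *
      split_ifs at * <;> omega
    · obtain ⟨s, t, hst, es, et⟩ := hL.clasp (-n - 4) (by omega)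
      obtain ⟨s, rfl⟩ := hsurj s
      obtain ⟨t, rfl⟩ := hsurj t
      exact ⟨t, s, by rw [hφ, hφ, hst], by omega, by omega⟩

/-! ### The invariant of knot projections. -/

/-- Some parametrization of `P` can be labelled by the arcs of the ring of boxes. -/
def KnotProjection.HasRingLabelling (P : KnotProjection) : Prop :=
  ∃ γ, Parametrizes γ P.1 ∧ ∃ L, RingLabelling γ L

lemma KnotProjection.HasRingLabelling.exists_of_parametrizes {P : KnotProjection}
    (h : P.HasRingLabelling) (hδ : Parametrizes δ P.1) : ∃ L, RingLabelling δ L := by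
  obtain ⟨γ, hγ, L, hL⟩ := h
  exact hL.reparametrize hγ.1 hδ.1 (hδ.2.trans hγ.2.symm)

lemma KnotProjection.IsTrivial.not_hasRingLabelling {P : KnotProjection} (h : P.IsTrivial) :
    ¬ P.HasRingLabelling := by
  intro hP
  obtain ⟨γ, hγ, hinj⟩ := h
  obtain ⟨L, hL⟩ := hP.exists_of_parametrizes hγ
  exact hL.not_injOn hγ.1.periodic hinj

lemma KnotProjection.HasRingLabelling.comp_diffeomorph {P Q : KnotProjection}
    (hP : P.HasRingLabelling) (h : Diffeomorph (𝓡 2) (𝓡 2) Sphere2 Sphere2 ∞)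
    (hPQ : (fun x => h x) '' P.1 = Q.1) : Q.HasRingLabelling := by
  obtain ⟨γ, hγ, L, hL⟩ := hP
  refine ⟨fun t => h (γ t), ⟨hγ.1.comp_diffeomorph h, ?_⟩, L, hL.mono, hL.add_one,
    fun s t hst => hL.sameBox s t (h.injective hst), fun n hn => ?_⟩
  · rw [← hPQ, ← hγ.2, ← Set.range_comp]
    rfl
  · obtain ⟨s, t, hst, e⟩ := hL.clasp n hn
    exact ⟨s, t, by rw [hst], e⟩

lemma SphereIsotopic.hasRingLabelling_iff {P Q : KnotProjection} (h : SphereIsotopic P Q) :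
    P.HasRingLabelling ↔ Q.HasRingLabelling := by
  obtain ⟨H, -, -, hH⟩ := h
  refine ⟨fun hP => hP.comp_diffeomorph (H 1) hH, fun hQ => hQ.comp_diffeomorph (H 1).symm ?_⟩
  rw [← hH, Set.image_image]
  simp

lemma ReidemeisterI.hasRingLabelling_iff {P Q : KnotProjection} (h : ReidemeisterI P Q) :
    P.HasRingLabelling ↔ Q.HasRingLabelling := by
  obtain ⟨γ, δ, hγ, hδ, a, b, hD, hinj, s, t, hs, hst, ht, he, hu⟩ := h
  refine ⟨fun hP => ⟨δ, hδ, ?_⟩, fun hQ => ⟨γ, hγ, ?_⟩⟩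
  · obtain ⟨L, hL⟩ := hP.exists_of_parametrizes hγ
    exact hL.reidemeisterI hγ.1.periodic hδ.1.periodic hD hinj
  · obtain ⟨L, hL⟩ := hQ.exists_of_parametrizes hδ
    exact hL.reidemeisterI_symm hγ.1.periodic hδ.1.periodic hD hs hst ht he hu

lemma ReidemeisterIII.hasRingLabelling_iff {P Q : KnotProjection} (h : ReidemeisterIII P Q) :
    P.HasRingLabelling ↔ Q.HasRingLabelling := by
  obtain ⟨γ, δ, hγ, hδ, a, b, hD, x, y, hx, hy, -⟩ := h
  refine ⟨fun hP => ⟨δ, hδ, ?_⟩, fun hQ => ⟨γ, hγ, ?_⟩⟩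
  · obtain ⟨L, hL⟩ := hP.exists_of_parametrizes hγ
    exact hL.reidemeisterIII hγ.1.periodic hδ.1.periodic hD hx hy
  · obtain ⟨L, hL⟩ := hQ.exists_of_parametrizes hδ
    exact hL.reidemeisterIII hδ.1.periodic hγ.1.periodic hD.symm hy hx

lemma OneThreeHomotopic.hasRingLabelling_iff {P Q : KnotProjection} (h : OneThreeHomotopic P Q) :
    P.HasRingLabelling ↔ Q.HasRingLabelling := by
  induction h with
  | rel P Q h =>
    rcases h with h | h | h
    exacts [h.hasRingLabelling_iff, h.hasRingLabelling_iff, h.hasRingLabelling_iff]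
  | refl P => rfl
  | symm P Q _ ih => exact ih.symm
  | trans P Q R _ _ ih ih' => exact ih.trans ih'

theorem theorem1 (P T : KnotProjection) (hP : P.HasGaussWord sevenBoxWord) (hT : T.IsTrivial) :
    ¬ OneThreeHomotopic P T :=
  fun h => hT.not_hasRingLabelling (h.hasRingLabelling_iff.1 hP.exists_ringLabelling)
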